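/- Let $\mathbb{F}_q$ be a finite field, let $n,m\ge 0$ be integers, and let $\mathcal R$ be a probability distribution on $\{0,1,\dots,\min\{n,m\}\}$. Write $\mathbb{F}_q^{n\times m,s}$ for the set of $n\times m$ matrices of rank $s$ over $\mathbb{F}_q$, and $\mathrm{row}(M)$ for the row space of $M$. Let $\binom{a}{d}_q$ denote the number of $d$-dimensional subspaces of $\mathbb{F}_q^a$ (so it is $0$ if $d<0$ or $d>a$). Logarithms and entropies are taken to a fixed base $b>1$, and $0\log(x/0)=0$. For a $u$-dimensional subspace $U\subseteq\mathbb{F}_q^m$, let $f_0(u)$ be the number of $n\times m$ matrices with row space $U$. For an $n\times m$ matrix $M$ of rank $u$ and a $v$-dimensional subspace $V\subseteq\mathbb{F}_q^m$ with $\dim((\mathrm{row}(M)+V)/V)=h$, let $f_1(u,v,h;s)$ be the number of $B\in\mathbb{F}_q^{n\times m,s}$ with $\mathrm{row}(M+B)=V$. Then for fixed $q,n,m$ these numbers depend only on $u$, respectively on $u,v,h,s$ (if no such $U$, respectively $(M,V)$, exists, the value is set to $0$). Let $M$ be a fixed $n\times m$ matrix of rank $r$. Let $A$ be uniformly distributed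 on $\mathrm{GL}(n,q)$ and let $B$ be independent of $A$ and obtained by choosing a rank $s$ according to $\mathcal R$ and then a uniformly random matrix in $\mathbb{F}_q^{n\times m,s}$. Then the entropy $h_r=H(A(M+B))$ is $$h_r=\sum_{v=0}^{\min\{n,m\}}\ \sum_{h=0}^{r} q^{(v-r+h)h}\binom{m-r}{v-r+h}_q\binom{r}{r-h}_q\; p_{v,h}\,\log\!\left(\frac{f_0(v)}{p_{v,h}}\right),$$ where $$p_{v,h}=\sum_{s=h}^{\min\{n,m,v+h\}}\mathcal R(s)\,\frac{f_1(r,v,h;s)}{|\mathbb{F}_q^{n\times m,s}|}.$$ -/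

import Mathlib

open scoped BigOperators

namespace GammaChannel

/-- The row space of a matrix: the span of its rows. -/
def rowSpace {F : Type*} [Field F] {n m : ℕ} (M : Matrix (Fin n) (Fin m) F) :
    Submodule F (Fin m → F) :=
  Submodule.span F (Set.range M.row)

/-- The Gaussian binomial coefficient: the number of `d`-dimensional subspaces of the
`a`-dimensional space `F^a`. The lower index is an integer; there are no subspaces of negative
dimension, so the coefficient is `0` for `d < 0` (and likewise for `d > a`). -/
noncomputable def gaussBinom (F : Type*) [Field F] (a : ℕ) (d : ℤ) : ℕ :=
  Nat.card {W : Submodule F (Fin a → F) // (Module.finrank F W : ℤ) = d}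

/-- The number of `n × m` matrices over `F` of rank `s`. -/
noncomputable def numRank (F : Type*) [Field F] (n m s : ℕ) : ℕ :=
  Nat.card {B : Matrix (Fin n) (Fin m) F // B.rank = s}

/-- The dimension of `(U + V) / V`, that is, of the image of `U` in the quotient by `V`. -/
noncomputable def quotDim {F : Type*} [Field F] {m : ℕ} (U V : Submodule F (Fin m → F)) : ℕ :=
  Module.finrank F (U.map V.mkQ)

open Classical in
/-- `f₀(u)`: the number of `n × m` matrices whose row space is a given `u`-dimensional subspace
`U` of `F^m` (evaluated at a chosen `U`; `0` if there is no such `U`). -/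
noncomputable def f0 (F : Type*) [Field F] (n m u : ℕ) : ℕ :=
  if hU : ∃ U : Submodule F (Fin m → F), Module.finrank F U = u then
    Nat.card {M : Matrix (Fin n) (Fin m) F // rowSpace M = hU.choose}
  else 0

open Classical in
/-- `f₁(u, v, h; s)`: for a given matrix `M` of rank `u`, with row space `U`, and a given
`v`-dimensional subspace `V` with `dim ((U + V) / V) = h`, the number of `n × m` matrices `B` of
rank `s` such that `M + B` has row space `V` (evaluated at a chosen pair `(M, V)`; `0` if there
is no such pair). -/
noncomputable def f1 (F : Type*) [Field F] (n m u v h s : ℕ) : ℕ :=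
  if hp : ∃ p : Matrix (Fin n) (Fin m) F × Submodule F (Fin m → F),
      p.1.rank = u ∧ Module.finrank F p.2 = v ∧ quotDim (rowSpace p.1) p.2 = h then
    Nat.card {B : Matrix (Fin n) (Fin m) F //
      B.rank = s ∧ rowSpace (hp.choose.1 + B) = hp.choose.2}
  else 0

/-- There are `n × m` matrices of every rank `s ≤ min n m`. -/
theorem exists_rank_eq (F : Type*) [Field F] (n m : ℕ) (s : Fin (min n m + 1)) :
    ∃ M : Matrix (Fin n) (Fin m) F, M.rank = s := by
  have hn : (s : ℕ) ≤ n := by omega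
  have hm : (s : ℕ) ≤ m := by omega
  let E : Matrix (Fin n) (Fin s) F := Matrix.of fun i j => if i = Fin.castLE hn j then 1 else 0
  let E' : Matrix (Fin s) (Fin m) F := Matrix.of fun i j => if j = Fin.castLE hm i then 1 else 0
  have h1 : E.transpose * E = 1 := by
    ext i j
    simp [E, Matrix.mul_apply, Matrix.one_apply, Fin.castLE_inj, eq_comm]
  have h2 : E' * E'.transpose = 1 := by
    ext i j
    simp [E', Matrix.mul_apply, Matrix.one_apply, Fin.castLE_inj, eq_comm]
  have h3 : E.transpose * (E * E') * E'.transpose = 1 := by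
    rw [← Matrix.mul_assoc, h1, Matrix.one_mul, h2]
  refine ⟨E * E', le_antisymm ?_ ?_⟩
  · exact (Matrix.rank_mul_le_left _ _).trans (by simpa using E.rank_le_width)
  · calc (s : ℕ) = (E.transpose * (E * E') * E'.transpose).rank := by
          rw [h3, Matrix.rank_one, Fintype.card_fin]
      _ ≤ (E.transpose * (E * E')).rank := Matrix.rank_mul_le_left _ _
      _ ≤ (E * E').rank := Matrix.rank_mul_le_right _ _

/-- The uniform distribution on the `n × m` matrices of rank `s`. -/
noncomputable def uniformRank (F : Type*) [Field F] [Fintype F] [DecidableEq F] (n m : ℕ)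
    (s : Fin (min n m + 1)) : PMF (Matrix (Fin n) (Fin m) F) :=
  PMF.uniformOfFinset (Finset.univ.filter fun M : Matrix (Fin n) (Fin m) F => M.rank = s)
    (by
      obtain ⟨M, hM⟩ := exists_rank_eq F n m s
      exact ⟨M, by simpa using hM⟩)

/-- The Uniform Given Rank distribution with rank distribution `R`: choose a rank `s` according
to `R`, then a matrix of rank `s` uniformly. -/
noncomputable def ugr (F : Type*) [Field F] [Fintype F] [DecidableEq F] (n m : ℕ)
    (R : PMF (Fin (min n m + 1))) : PMF (Matrix (Fin n) (Fin m) F) :=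
  R.bind (uniformRank F n m)

/-- The law of the output `A (M + B)` of the Gamma channel with error rank distribution `R` on
the fixed input `M`: `A` is uniform in `GL(n, F)`, `B` is UGR with rank distribution `R`, and
`A` and `B` are independent. -/
noncomputable def outputLaw {F : Type*} [Field F] [Fintype F] [DecidableEq F] {n m : ℕ}
    (R : PMF (Fin (min n m + 1))) (M : Matrix (Fin n) (Fin m) F) :
    PMF (Matrix (Fin n) (Fin m) F) :=
  (PMF.uniformOfFintype (GL (Fin n) F)).bind fun A =>
    (ugr F n m R).map fun B => (A : Matrix (Fin n) (Fin n) F) * (M + B)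

/-- The Shannon entropy, with logarithms to base `b`, of a distribution on a finite set. -/
noncomputable def entropy {α : Type*} [Fintype α] (b : ℝ) (P : PMF α) : ℝ :=
  -∑ y, (P y).toReal * Real.logb b (P y).toReal

/-- `∑ R(s) f₁(r, v, h; s) / |F^{n × m, s}|` over the ranks `s` with `h ≤ s ≤ min {n, m, v + h}`. -/
noncomputable def rowProb (F : Type*) [Field F] (n m : ℕ) (R : PMF (Fin (min n m + 1)))
    (r v h : ℕ) : ℝ :=
  ∑ s : Fin (min n m + 1) with h ≤ s.val ∧ s.val ≤ v + h,
    (R s).toReal * ((f1 F n m r v h s : ℝ) / (numRank F n m s : ℝ))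

end GammaChannel

/-! Since `A` is uniform on `GL(n)`, the output law is constant on orbits of left multiplication,
and these orbits are the sets of matrices with a common row space (`outputLaw_gl_mul`,
`exists_gl_mul_eq`). If the output has row space `V` with probability `p`, each of the `f₀(dim V)`
matrices over `V` has probability `p / f₀`, so together they contribute `p log (f₀ / p)` to the
entropy.

As `A` does not change row spaces, `p` is the probability that `row (M + B) = V`. The maps `B ↦ P B
Q`, with `P` and `Q` invertible, show that it depends on `V` only through `v = dim V` and `h = dim
((row M + V) / V)`, because pairs of subspaces are classified by their dimensions and that of their
intersection.

It remains to count the `V` with given `v` and `h`. With `S = row M` and a complement `T`, such a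
`V` is given by `W = S ⊓ V` of dimension `r - h`, its projection `X` to `T` of dimension `v - r +
h`, and a linear map `X → S / W`. As `dim (S / W) = h`, there are `q ^ ((v - r + h) h)` such maps.
-/

namespace GammaChannel

/-! ### Isomorphisms between configurations of subspaces -/

section LinearAlgebra

variable {K E E' : Type*} [Field K] [AddCommGroup E] [Module K E] [AddCommGroup E'] [Module K E']

/-- Isomorphisms between the parts of two direct sum decompositions glue. -/
theorem exists_linearEquiv_of_isCompl {p q : Submodule K E} {p' q' : Submodule K E'}
    (h : IsCompl p q) (h' : IsCompl p' q') (e₁ : p ≃ₗ[K] p') (e₂ : q ≃ₗ[K] q') :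
    ∃ e : E ≃ₗ[K] E', (∀ x : p, e x = e₁ x) ∧ ∀ x : q, e x = e₂ x := by
  refine ⟨(p.prodEquivOfIsCompl q h).symm ≪≫ₗ (e₁.prodCongr e₂) ≪≫ₗ p'.prodEquivOfIsCompl q' h',
    fun x => ?_, fun x => ?_⟩
  · simp
  · simp

theorem finrank_eq_of_isCompl [FiniteDimensional K E] [FiniteDimensional K E']
    {p q : Submodule K E} {p' q' : Submodule K E'} (h : IsCompl p q) (h' : IsCompl p' q')
    (hE : Module.finrank K E = Module.finrank K E')
    (hp : Module.finrank K p = Module.finrank K p') :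
    Module.finrank K q = Module.finrank K q' := by
  have h₁ := Submodule.finrank_add_eq_of_isCompl h
  have h₂ := Submodule.finrank_add_eq_of_isCompl h'
  omega

/-- Subspaces of equal dimension are equivalent under an isomorphism of the ambient spaces. -/
theorem exists_linearEquiv_map_eq [FiniteDimensional K E] [FiniteDimensional K E']
    (hE : Module.finrank K E = Module.finrank K E') (p : Submodule K E) (p' : Submodule K E')
    (hp : Module.finrank K p = Module.finrank K p') :
    ∃ e : E ≃ₗ[K] E', p.map (e : E →ₗ[K] E') = p' := by
  obtain ⟨q, h⟩ := exists_isCompl p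
  obtain ⟨q', h'⟩ := exists_isCompl p'
  obtain ⟨e, he, -⟩ := exists_linearEquiv_of_isCompl h h' (LinearEquiv.ofFinrankEq p p' hp)
    (LinearEquiv.ofFinrankEq q q' (finrank_eq_of_isCompl h h' hE hp))
  refine ⟨e, Submodule.eq_of_le_of_finrank_eq ?_ ?_⟩
  · rintro _ ⟨x, hx, rfl⟩
    simpa using (he ⟨x, hx⟩).symm ▸ Subtype.coe_prop _
  · rw [LinearEquiv.finrank_map_eq, hp]

/-- Flags of two subspaces with equal dimensions are isomorphic. -/
theorem exists_linearEquiv_map_eq_of_le [FiniteDimensional K E] [FiniteDimensional K E']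
    {p a : Submodule K E} {p' a' : Submodule K E'} (hap : a ≤ p) (hap' : a' ≤ p')
    (hp : Module.finrank K p = Module.finrank K p')
    (ha : Module.finrank K a = Module.finrank K a') :
    ∃ e : p ≃ₗ[K] p', ∀ x : p, (x : E) ∈ a → (e x : E') ∈ a' := by
  obtain ⟨e, he⟩ := exists_linearEquiv_map_eq hp (a.comap p.subtype) (a'.comap p'.subtype) (by
    rw [(Submodule.comapSubtypeEquivOfLe hap).finrank_eq,
      (Submodule.comapSubtypeEquivOfLe hap').finrank_eq, ha])
  refine ⟨e, fun x hx => ?_⟩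
  have : e x ∈ a'.comap p'.subtype := he ▸ ⟨x, hx, rfl⟩
  exact this

/-- Given subspaces `a` and `b`, the ambient space decomposes compatibly with both. -/
theorem exists_isCompl_inf_sup_eq [FiniteDimensional K E] (a b : Submodule K E) :
    ∃ c t : Submodule K E, IsCompl b t ∧ c ≤ t ∧ a ⊓ b ⊔ c = a ∧
      Module.finrank K (a ⊓ b : Submodule K E) + Module.finrank K c = Module.finrank K a := by
  obtain ⟨c, hc, hc'⟩ := IsModularLattice.exists_disjoint_and_sup_eq (inf_le_left : a ⊓ b ≤ a)
  have hca : c ≤ a := hc' ▸ le_sup_right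
  -- `c ⊓ b` lies in `a ⊓ b`, to which `c` is complementary in `a`; so some complement `t` of `b`
  -- contains `c`.
  have hcb : Disjoint c b := by
    rw [disjoint_iff_inf_le] at hc ⊢
    exact (le_inf (le_inf (inf_le_left.trans hca) inf_le_right) inf_le_left).trans hc
  obtain ⟨t, hct, ht⟩ := hcb.exists_isCompl
  refine ⟨c, t, ht.symm, hct, hc', ?_⟩
  have := Submodule.finrank_sup_add_finrank_inf_eq (a ⊓ b) c
  rw [hc', hc.eq_bot, finrank_bot] at this
  omega

/-- Pairs of subspaces with the same dimensions and the same dimension of the intersection are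
equivalent under an isomorphism of the ambient spaces. -/
theorem exists_linearEquiv_map_eq_and_map_eq [FiniteDimensional K E] [FiniteDimensional K E']
    (hE : Module.finrank K E = Module.finrank K E') {u v : Submodule K E} {u' v' : Submodule K E'}
    (hu : Module.finrank K u = Module.finrank K u')
    (hv : Module.finrank K v = Module.finrank K v')
    (huv : Module.finrank K (u ⊓ v : Submodule K E) = Module.finrank K (u' ⊓ v' : Submodule K E')) :
    ∃ e : E ≃ₗ[K] E', u.map (e : E →ₗ[K] E') = u' ∧ v.map (e : E →ₗ[K] E') = v' := by
  obtain ⟨c, t, ht, hct, hsup, hc⟩ := exists_isCompl_inf_sup_eq u v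
  obtain ⟨c', t', ht', hct', hsup', hc'⟩ := exists_isCompl_inf_sup_eq u' v'
  -- `e₁ : v ≃ v'` respects the intersections and `e₂ : t ≃ t'` takes `c` into `c'`. As `u = (u ⊓ v)
  -- ⊔ c`, the glued map takes `u` into `u'`.
  obtain ⟨e₁, he₁⟩ := exists_linearEquiv_map_eq_of_le (inf_le_right : u ⊓ v ≤ v)
    (inf_le_right : u' ⊓ v' ≤ v') hv huv
  obtain ⟨e₂, he₂⟩ := exists_linearEquiv_map_eq_of_le hct hct'
    (finrank_eq_of_isCompl ht ht' hE hv) (by omega)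
  obtain ⟨e, h₁, h₂⟩ := exists_linearEquiv_of_isCompl ht ht' e₁ e₂
  refine ⟨e, Submodule.eq_of_le_of_finrank_eq ?_ ?_, Submodule.eq_of_le_of_finrank_eq ?_ ?_⟩
  · rw [← hsup, Submodule.map_sup, sup_le_iff, Submodule.map_le_iff_le_comap,
      Submodule.map_le_iff_le_comap]
    refine ⟨fun x hx => ?_, fun x hx => ?_⟩
    · have := he₁ ⟨x, hx.2⟩ hx
      rw [← h₁] at this
      exact this.1
    · have := he₂ ⟨x, hct hx⟩ hx
      rw [← h₂] at this
      exact hsup'.le (Submodule.mem_sup_right this)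
  · rw [LinearEquiv.finrank_map_eq, hu]
  · rintro _ ⟨x, hx, rfl⟩
    exact (h₁ ⟨x, hx⟩).symm ▸ (e₁ ⟨x, hx⟩).2
  · rw [LinearEquiv.finrank_map_eq, hv]

/-- Linear maps with the same range differ by an automorphism of the domain. -/
theorem exists_linearEquiv_comp_eq [FiniteDimensional K E] (f g : E →ₗ[K] E')
    (h : LinearMap.range f = LinearMap.range g) :
    ∃ e : E ≃ₗ[K] E, g ∘ₗ (e : E →ₗ[K] E) = f := by
  obtain ⟨p, hp⟩ := exists_isCompl (LinearMap.ker f)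
  obtain ⟨q, hq⟩ := exists_isCompl (LinearMap.ker g)
  have hk : Module.finrank K (LinearMap.ker f) = Module.finrank K (LinearMap.ker g) := by
    have h₁ := f.finrank_range_add_finrank_ker
    have h₂ := g.finrank_range_add_finrank_ker
    rw [h] at h₁
    omega
  -- Complements of the kernels are matched through the common range; the kernels may be matched
  -- arbitrarily.
  let i := (Submodule.quotientEquivOfIsCompl _ p hp).symm ≪≫ₗ f.quotKerEquivRange ≪≫ₗ
    LinearEquiv.ofEq _ _ h ≪≫ₗ g.quotKerEquivRange.symm ≪≫ₗ
      Submodule.quotientEquivOfIsCompl _ q hq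
  have hi : ∀ x : p, g (i x) = f x := by
    intro x
    have h₁ : g.quotKerEquivRange ((Submodule.quotientEquivOfIsCompl _ q hq).symm (i x)) =
        LinearEquiv.ofEq _ _ h (f.quotKerEquivRange
          ((Submodule.quotientEquivOfIsCompl _ p hp).symm x)) := by
      simp [i]
    simpa using congrArg Subtype.val h₁
  obtain ⟨e, he₁, he₂⟩ := exists_linearEquiv_of_isCompl hp hq (LinearEquiv.ofFinrankEq _ _ hk) i
  refine ⟨e, LinearMap.ext fun x => ?_⟩
  obtain ⟨y, hy, z, hz, rfl⟩ := Submodule.mem_sup.1 (hp.sup_eq_top ▸ Submodule.mem_top : x ∈ _)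
  have h₁ : g (e y) = 0 := he₁ ⟨y, hy⟩ ▸ (LinearEquiv.ofFinrankEq _ _ hk ⟨y, hy⟩).2
  have h₂ : g (e z) = f z := he₂ ⟨z, hz⟩ ▸ hi ⟨z, hz⟩
  simp [h₁, h₂, LinearMap.mem_ker.1 hy]

end LinearAlgebra
-- Counting subspaces by their intersection with a fixed one
section Counting

variable {K C U E : Type*} [Field K] [AddCommGroup C] [Module K C] [AddCommGroup U] [Module K U]
  [AddCommGroup E] [Module K E]

/-- Rank-nullity for the first projection on `V`, whose kernel consists of the vectors `(0, u)` in
`V`. -/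
theorem finrank_map_fst_add_finrank_comap_inr [FiniteDimensional K C] [FiniteDimensional K U]
    (V : Submodule K (C × U)) :
    Module.finrank K (V.map (LinearMap.fst K C U)) +
      Module.finrank K (V.comap (LinearMap.inr K C U)) = Module.finrank K V := by
  rw [← ((LinearMap.fst K C U).domRestrict V).finrank_range_add_finrank_ker,
    LinearMap.range_domRestrict]
  congr 1
  refine LinearEquiv.finrank_eq (LinearEquiv.ofBijective
    (((LinearMap.inr K C U).restrict (p := V.comap (LinearMap.inr K C U)) (q := V)
      fun _ h => h).codRestrict _ fun x => ?_) ⟨fun x y h => ?_, fun y => ?_⟩)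
  · exact LinearMap.mem_ker.2 rfl
  · exact Subtype.ext (congrArg (fun z => z.1.1.2) h)
  · obtain ⟨⟨⟨c, u⟩, h⟩, hy⟩ := y
    obtain rfl : c = 0 := by simpa using hy
    exact ⟨⟨u, h⟩, rfl⟩

/-- The subspaces of `C × U` that meet `U` in `W` are the graphs of the partial linear maps from
`C` to `U ⧸ W`. -/
noncomputable def submoduleProdEquiv (W : Submodule K U) :
    {V : Submodule K (C × U) // V.comap (LinearMap.inr K C U) = W} ≃ (C →ₗ.[K] U ⧸ W) where
  toFun V := (V.1.map (LinearMap.id.prodMap W.mkQ)).toLinearPMap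
  invFun p := ⟨p.graph.comap (LinearMap.id.prodMap W.mkQ), by
    ext u
    rw [Submodule.mem_comap, Submodule.mem_comap, ← Submodule.Quotient.mk_eq_zero W]
    change ((0 : C), W.mkQ u) ∈ p.graph ↔ W.mkQ u = 0
    exact ⟨fun h => p.graph_fst_eq_zero_snd h rfl, fun h => h ▸ p.graph.zero_mem⟩⟩
  left_inv := by
    rintro ⟨V, rfl⟩
    ext1
    dsimp only
    -- `V` contains the kernel `0 × W` of the projection to `C × (U ⧸ W)`, so its image determines
    -- it; the image meets `0 × (U ⧸ W)` trivially, so it is a graph.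
    rw [Submodule.toLinearPMap_graph_eq, Submodule.comap_map_eq_self]
    · rintro ⟨c, u⟩ h
      obtain ⟨rfl, hu⟩ := Prod.ext_iff.1 (LinearMap.mem_ker.1 h)
      exact (Submodule.Quotient.mk_eq_zero (V.comap (LinearMap.inr K C U))).1 hu
    · rintro _ ⟨⟨c, u⟩, h, rfl⟩ hc
      obtain rfl : c = 0 := hc
      exact (Submodule.Quotient.mk_eq_zero _).2 h
  right_inv p := by
    apply LinearPMap.eq_of_eq_graph
    dsimp only
    rw [Submodule.map_comap_eq_of_surjective, Submodule.toLinearPMap_graph_eq]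
    · exact fun x hx h => p.graph_fst_eq_zero_snd (x := x.1) (x' := x.2) hx h
    · exact Function.surjective_id.prodMap W.mkQ_surjective

theorem submoduleProdEquiv_domain (W : Submodule K U)
    (V : {V : Submodule K (C × U) // V.comap (LinearMap.inr K C U) = W}) :
    (submoduleProdEquiv W V).domain = V.1.map (LinearMap.fst K C U) := by
  change Submodule.map _ (Submodule.map _ _) = _
  rw [← Submodule.map_comp]
  rfl

theorem card_linearPMap [Fintype K] [Finite C] [Finite U] (k : ℕ) :
    Nat.card {p : C →ₗ.[K] U // Module.finrank K p.domain = k} =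
      Nat.card {X : Submodule K C // Module.finrank K X = k} *
        Fintype.card K ^ (k * Module.finrank K U) := by
  have e : {p : C →ₗ.[K] U // Module.finrank K p.domain = k} ≃
      Σ X : {X : Submodule K C // Module.finrank K X = k}, X.1 →ₗ[K] U :=
    { toFun := fun p => ⟨⟨p.1.domain, p.2⟩, p.1.toFun⟩
      invFun := fun p => ⟨⟨p.1.1, p.2⟩, p.1.2⟩
      left_inv := fun _ => rfl
      right_inv := fun _ => rfl }
  have := Fintype.ofFinite {X : Submodule K C // Module.finrank K X = k}
  have (X : Submodule K C) : Finite (X →ₗ[K] U) := Finite.of_injective _ DFunLike.coe_injective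
  rw [Nat.card_congr e, Nat.card_sigma, Finset.sum_congr rfl (g := fun _ =>
    Fintype.card K ^ (k * Module.finrank K U))]
  · simp
  · intro X _
    have := Fintype.ofFinite (X.1 →ₗ[K] U)
    rw [Nat.card_eq_fintype_card, Module.card_eq_pow_finrank (K := K), Module.finrank_linearMap,
      X.2]

theorem card_submodule_prod_comap_inr_eq [Fintype K] [Finite C] [Finite U] (W : Submodule K U)
    (k : ℕ) :
    Nat.card {V : Submodule K (C × U) //
        Module.finrank K V = k + Module.finrank K W ∧ V.comap (LinearMap.inr K C U) = W} =
      Nat.card {X : Submodule K C // Module.finrank K X = k} *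
        Fintype.card K ^ (k * (Module.finrank K U - Module.finrank K W)) := by
  have : Finite (U ⧸ W) := Finite.of_surjective _ W.mkQ_surjective
  rw [← Submodule.finrank_quotient, ← card_linearPMap]
  refine Nat.card_congr (((Equiv.subtypeEquivRight fun V => and_comm).trans
    (Equiv.subtypeSubtypeEquivSubtypeInter _ _).symm).trans
      ((submoduleProdEquiv W).subtypeEquiv fun V => ?_))
  rw [submoduleProdEquiv_domain]
  have := finrank_map_fst_add_finrank_comap_inr V.1
  rw [V.2] at this
  omega

theorem card_submodule_prod [Fintype K] [Finite C] [Finite U] (k d : ℕ) :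
    Nat.card {V : Submodule K (C × U) // Module.finrank K V = k + d ∧
        Module.finrank K (V.comap (LinearMap.inr K C U)) = d} =
      Nat.card {X : Submodule K C // Module.finrank K X = k} *
        Nat.card {W : Submodule K U // Module.finrank K W = d} *
          Fintype.card K ^ (k * (Module.finrank K U - d)) := by
  have e : {V : Submodule K (C × U) // Module.finrank K V = k + d ∧
        Module.finrank K (V.comap (LinearMap.inr K C U)) = d} ≃
      Σ W : {W : Submodule K U // Module.finrank K W = d}, {V : Submodule K (C × U) //
        Module.finrank K V = k + Module.finrank K W.1 ∧ V.comap (LinearMap.inr K C U) = W.1} :=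
    { toFun := fun V => ⟨⟨V.1.comap (LinearMap.inr K C U), V.2.2⟩, V.1,
        V.2.1.trans (congrArg (k + ·) V.2.2.symm), rfl⟩
      invFun := fun V => ⟨V.2.1, by rw [V.2.2.1, V.1.2], by rw [V.2.2.2, V.1.2]⟩
      left_inv := fun _ => rfl
      right_inv := by
        rintro ⟨⟨W, hW⟩, V, hV, hVW⟩
        dsimp only at hVW
        subst hVW
        rfl }
  have := Fintype.ofFinite {W : Submodule K U // Module.finrank K W = d}
  rw [Nat.card_congr e, Nat.card_sigma, Finset.sum_congr rfl fun W _ =>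
    (card_submodule_prod_comap_inr_eq W.1 k).trans (by rw [W.2])]
  simp
  ring

theorem card_submodule_finrank_eq [FiniteDimensional K E] (d : ℕ) :
    Nat.card {X : Submodule K E // Module.finrank K X = d} =
      gaussBinom K (Module.finrank K E) d := by
  have e : E ≃ₗ[K] (Fin (Module.finrank K E) → K) := LinearEquiv.ofFinrankEq _ _ (by simp)
  refine Nat.card_congr ((Submodule.orderIsoMapComap e).toEquiv.subtypeEquiv fun X => ?_)
  change _ ↔ (Module.finrank K (X.map (e : E →ₗ[K] (Fin (Module.finrank K E) → K))) : ℤ) = d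
  rw [LinearEquiv.finrank_map_eq, Nat.cast_inj]

theorem card_submodule_finrank_inf_eq [Fintype K] [Finite E] (S : Submodule K E) (k d : ℕ) :
    Nat.card {V : Submodule K E // Module.finrank K V = k + d ∧
        Module.finrank K (S ⊓ V : Submodule K E) = d} =
      gaussBinom K (Module.finrank K E - Module.finrank K S) k *
        gaussBinom K (Module.finrank K S) d *
          Fintype.card K ^ (k * (Module.finrank K S - d)) := by
  obtain ⟨T, hT⟩ := exists_isCompl S
  have hd := Submodule.finrank_add_eq_of_isCompl hT
  rw [← hd, Nat.add_sub_cancel_left, ← card_submodule_finrank_eq, ← card_submodule_finrank_eq,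
    ← card_submodule_prod]
  let e := T.prodEquivOfIsCompl S hT.symm
  refine Nat.card_congr ((Submodule.orderIsoMapComap e.symm).toEquiv.subtypeEquiv fun V =>
    and_congr (Eq.congr_left ?_) (Eq.congr_left ?_))
  · exact (LinearEquiv.finrank_map_eq e.symm V).symm
  have h : (V.map (e.symm : E →ₗ[K] T × S)).comap (LinearMap.inr K T S) = V.comap S.subtype := by
    ext x
    rw [Submodule.mem_comap, Submodule.mem_map_equiv]
    simp [e]
  have h' : Module.finrank K (S ⊓ V : Submodule K E) =
      Module.finrank K ((V.map (e.symm : E →ₗ[K] T × S)).comap (LinearMap.inr K T S)) := by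
    rw [h, ← Submodule.map_comap_subtype, Submodule.finrank_map_subtype_eq]
  exact h'

/-- Rank-nullity for the quotient map restricted to `S`, whose kernel is `S ⊓ V`. -/
theorem quotDim_add_finrank_inf {m : ℕ} (S V : Submodule K (Fin m → K)) :
    quotDim S V + Module.finrank K (S ⊓ V : Submodule K (Fin m → K)) = Module.finrank K S := by
  rw [← (V.mkQ.domRestrict S).finrank_range_add_finrank_ker, LinearMap.range_domRestrict, quotDim,
    LinearMap.ker_domRestrict, Submodule.ker_mkQ, ← Submodule.map_comap_subtype,
    Submodule.finrank_map_subtype_eq]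

/-- The number of `v`-dimensional subspaces `V` with `dim ((S + V) / V) = h`. -/
theorem card_submodule_quotDim_eq [Fintype K] {m : ℕ} (S : Submodule K (Fin m → K)) {v h r : ℕ}
    (hr : Module.finrank K S = r) (hh : h ≤ r) :
    (Nat.card {V : Submodule K (Fin m → K) // Module.finrank K V = v ∧ quotDim S V = h} : ℝ) =
      (Fintype.card K : ℝ) ^ (((v : ℤ) - r + h) * h) *
        (gaussBinom K (m - r) ((v : ℤ) - r + h) : ℝ) * (gaussBinom K r ((r : ℤ) - h) : ℝ) := by
  -- `d = r - h` is the dimension of `S ⊓ V`.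
  obtain ⟨d, rfl⟩ := Nat.exists_eq_add_of_le hh
  have hq (V : Submodule K (Fin m → K)) := quotDim_add_finrank_inf S V
  rcases le_or_gt d v with hd | hd
  · obtain ⟨k, rfl⟩ := Nat.exists_eq_add_of_le' hd
    have h₁ : (((k + d : ℕ) : ℤ) - (h + d : ℕ) + h) = k := by push_cast; ring
    have h₂ : (((h + d : ℕ) : ℤ) - h) = d := by push_cast; ring
    rw [h₁, h₂, Nat.card_congr (Equiv.subtypeEquivRight (q := fun V : Submodule K (Fin m → K) => Module.finrank K V = k + d ∧
      Module.finrank K (S ⊓ V : Submodule K (Fin m → K)) = d) fun V => ?_),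
      card_submodule_finrank_inf_eq, hr, Module.finrank_fin_fun, Nat.add_sub_cancel]
    · rw [← Nat.cast_mul k h, zpow_natCast]
      push_cast
      ring
    · have := hq V
      exact and_congr_right fun _ => by omega
  -- For `v < d` no such `V` exists, and the lower index `v - d` is negative, so both sides vanish
  -- whatever the power of `q`.
  · have h₁ : gaussBinom K (m - (h + d)) ((v : ℤ) - (h + d : ℕ) + h) = 0 := by
      refine Nat.card_eq_zero.2 (Or.inl ⟨fun W => ?_⟩)
      have := W.2
      omega
    rw [h₁, Nat.card_eq_zero.2 (Or.inl ⟨fun V => ?_⟩)]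
    · simp
    · have h₂ := Submodule.finrank_mono (inf_le_right : S ⊓ V.1 ≤ V.1)
      have := V.2
      have := hq V
      omega

end Counting
-- Row spaces and multiplication by invertible matrices
section Matrices

variable {F : Type*} [Field F] {n m : ℕ}

theorem rowSpace_eq_range (M : Matrix (Fin n) (Fin m) F) :
    rowSpace M = LinearMap.range M.vecMulLinear :=
  (range_vecMulLinear M).symm

theorem finrank_rowSpace (M : Matrix (Fin n) (Fin m) F) :
    Module.finrank F (rowSpace M) = M.rank :=
  M.rank_eq_finrank_span_row.symm

theorem exists_vecMul_eq_linearEquiv {k : ℕ} (e : (Fin k → F) ≃ₗ[F] (Fin k → F)) :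
    ∃ P : GL (Fin k) F, (P : Matrix (Fin k) (Fin k) F).vecMulLinear = e := by
  have h (f : (Fin k → F) →ₗ[F] (Fin k → F)) : (LinearMap.toMatrixRight' f).vecMulLinear = f :=
    LinearMap.toMatrixRight'.symm_apply_apply f
  -- Matrices act on row vectors from the right, so the product applies `f` first.
  have h' (f g : (Fin k → F) ≃ₗ[F] (Fin k → F)) (hfg : ∀ x, g (f x) = x) :
      LinearMap.toMatrixRight' (f : (Fin k → F) →ₗ[F] (Fin k → F)) *
        LinearMap.toMatrixRight' (g : (Fin k → F) →ₗ[F] (Fin k → F)) = 1 := by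
    refine Matrix.vecMul_injective (funext fun x => ?_)
    dsimp only
    rw [← Matrix.vecMul_vecMul, Matrix.vecMul_one]
    have h₁ := LinearMap.congr_fun (h f) x
    have h₂ := LinearMap.congr_fun (h g) (f x)
    rw [Matrix.vecMulLinear_apply] at h₁ h₂
    rw [h₁]
    exact h₂.trans (hfg x)
  exact ⟨⟨_, _, h' e e.symm e.symm_apply_apply, h' e.symm e e.apply_symm_apply⟩, h _⟩

/-- Multiplication by invertible matrices on both sides. -/
def glMulEquiv (P : GL (Fin n) F) (Q : GL (Fin m) F) :
    Matrix (Fin n) (Fin m) F ≃ Matrix (Fin n) (Fin m) F where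
  toFun B := (P : Matrix (Fin n) (Fin n) F) * B * (Q : Matrix (Fin m) (Fin m) F)
  invFun B := ((P⁻¹ : GL (Fin n) F) : Matrix (Fin n) (Fin n) F) * B *
    ((Q⁻¹ : GL (Fin m) F) : Matrix (Fin m) (Fin m) F)
  left_inv B := by
    dsimp only
    rw [Matrix.mul_assoc, Matrix.mul_assoc, Matrix.mul_assoc, Units.mul_inv, Matrix.mul_one,
      ← Matrix.mul_assoc, Units.inv_mul, Matrix.one_mul]
  right_inv B := by
    dsimp only
    rw [Matrix.mul_assoc, Matrix.mul_assoc, Matrix.mul_assoc, Units.inv_mul, Matrix.mul_one,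
      ← Matrix.mul_assoc, Units.mul_inv, Matrix.one_mul]

theorem vecMulLinear_bijective {k : ℕ} (P : GL (Fin k) F) :
    Function.Bijective (P : Matrix (Fin k) (Fin k) F).vecMulLinear := by
  refine Function.bijective_iff_has_inverse.2
    ⟨((P⁻¹ : GL (Fin k) F) : Matrix (Fin k) (Fin k) F).vecMulLinear, fun x => ?_, fun x => ?_⟩
  · rw [Matrix.vecMulLinear_apply, Matrix.vecMulLinear_apply, Matrix.vecMul_vecMul, Units.mul_inv,
      Matrix.vecMul_one]
  · rw [Matrix.vecMulLinear_apply, Matrix.vecMulLinear_apply, Matrix.vecMul_vecMul, Units.inv_mul,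
      Matrix.vecMul_one]

theorem rowSpace_mul (M : Matrix (Fin n) (Fin m) F) (Q : Matrix (Fin m) (Fin m) F) :
    rowSpace (M * Q) = (rowSpace M).map Q.vecMulLinear := by
  have h : (M * Q).vecMulLinear = Q.vecMulLinear ∘ₗ M.vecMulLinear :=
    LinearMap.ext fun x => by simp
  rw [rowSpace_eq_range, rowSpace_eq_range, ← LinearMap.range_comp, h]

theorem rowSpace_gl_mul (P : GL (Fin n) F) (M : Matrix (Fin n) (Fin m) F) :
    rowSpace ((P : Matrix (Fin n) (Fin n) F) * M) = rowSpace M := by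
  have h : ((P : Matrix (Fin n) (Fin n) F) * M).vecMulLinear =
      M.vecMulLinear ∘ₗ (P : Matrix (Fin n) (Fin n) F).vecMulLinear :=
    LinearMap.ext fun x => by simp
  rw [rowSpace_eq_range, rowSpace_eq_range, h, LinearMap.range_comp,
    LinearMap.range_eq_top.2 (vecMulLinear_bijective P).2, Submodule.map_top]

theorem rowSpace_glMulEquiv (P : GL (Fin n) F) (Q : GL (Fin m) F)
    (B : Matrix (Fin n) (Fin m) F) :
    rowSpace (glMulEquiv P Q B) =
      (rowSpace B).map (Q : Matrix (Fin m) (Fin m) F).vecMulLinear := by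
  rw [← rowSpace_gl_mul P B, ← rowSpace_mul]
  rfl

theorem rank_glMulEquiv (P : GL (Fin n) F) (Q : GL (Fin m) F) (B : Matrix (Fin n) (Fin m) F) :
    (glMulEquiv P Q B).rank = B.rank := by
  rw [← finrank_rowSpace, ← finrank_rowSpace, rowSpace_glMulEquiv]
  exact LinearEquiv.finrank_map_eq (LinearEquiv.ofBijective _ (vecMulLinear_bijective Q)) _

/-- The maps `x ↦ x M` and `x ↦ x N` have the same range, so they differ by an automorphism `x ↦ x
P` of the domain. -/
theorem exists_gl_mul_eq {M N : Matrix (Fin n) (Fin m) F} (h : rowSpace M = rowSpace N) :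
    ∃ P : GL (Fin n) F, (P : Matrix (Fin n) (Fin n) F) * M = N := by
  rw [rowSpace_eq_range, rowSpace_eq_range] at h
  obtain ⟨e, he⟩ := exists_linearEquiv_comp_eq _ _ h.symm
  obtain ⟨P, hP⟩ := exists_vecMul_eq_linearEquiv e
  refine ⟨P, Matrix.vecMul_injective (funext fun x => ?_)⟩
  rw [← hP] at he
  simpa using LinearMap.congr_fun he x

theorem card_rowSpace_eq_of_finrank_eq {U U' : Submodule F (Fin m → F)}
    (h : Module.finrank F U = Module.finrank F U') :
    Nat.card {M : Matrix (Fin n) (Fin m) F // rowSpace M = U} =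
      Nat.card {M : Matrix (Fin n) (Fin m) F // rowSpace M = U'} := by
  obtain ⟨e, rfl⟩ := exists_linearEquiv_map_eq rfl U U' h
  obtain ⟨Q, hQ⟩ := exists_vecMul_eq_linearEquiv e
  refine Nat.card_congr ((glMulEquiv 1 Q).subtypeEquiv fun M => ?_)
  rw [rowSpace_glMulEquiv, hQ, (Submodule.map_injective_of_injective e.injective).eq_iff]

theorem card_rowSpace_eq_f0 (U : Submodule F (Fin m → F)) :
    Nat.card {M : Matrix (Fin n) (Fin m) F // rowSpace M = U} = f0 F n m (Module.finrank F U) := by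
  have h : ∃ U' : Submodule F (Fin m → F), Module.finrank F U' = Module.finrank F U := ⟨U, rfl⟩
  rw [f0, dif_pos h]
  exact card_rowSpace_eq_of_finrank_eq h.choose_spec.symm

/-- Some `Q` moves `(row M, V)` to `(row M', V')`, and then `P M Q = M'` for some `P`. The bijection
`B ↦ P B Q` preserves rank and takes `M + B` to `M' + P B Q`. -/
theorem card_rank_eq_and_rowSpace_add_eq_of_quotDim_eq {M M' : Matrix (Fin n) (Fin m) F}
    {V V' : Submodule F (Fin m → F)} (hM : M.rank = M'.rank)
    (hV : Module.finrank F V = Module.finrank F V')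
    (h : quotDim (rowSpace M) V = quotDim (rowSpace M') V') (s : ℕ) :
    Nat.card {B : Matrix (Fin n) (Fin m) F // B.rank = s ∧ rowSpace (M + B) = V} =
      Nat.card {B : Matrix (Fin n) (Fin m) F // B.rank = s ∧ rowSpace (M' + B) = V'} := by
  rw [← finrank_rowSpace, ← finrank_rowSpace] at hM
  obtain ⟨e, he, rfl⟩ := exists_linearEquiv_map_eq_and_map_eq rfl hM hV (by
    have h₁ := quotDim_add_finrank_inf (rowSpace M) V
    have h₂ := quotDim_add_finrank_inf (rowSpace M') V'
    omega)
  obtain ⟨Q, hQ⟩ := exists_vecMul_eq_linearEquiv e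
  rw [← hQ, ← rowSpace_mul] at he
  obtain ⟨P, rfl⟩ := exists_gl_mul_eq he
  refine Nat.card_congr ((glMulEquiv P Q).subtypeEquiv fun B => ?_)
  have h₁ : (P : Matrix (Fin n) (Fin n) F) * (M * (Q : Matrix (Fin m) (Fin m) F)) +
      glMulEquiv P Q B = glMulEquiv P Q (M + B) := by
    simp only [glMulEquiv, Equiv.coe_fn_mk, Matrix.mul_add, Matrix.add_mul, Matrix.mul_assoc]
  rw [rank_glMulEquiv, h₁, rowSpace_glMulEquiv, hQ,
    (Submodule.map_injective_of_injective e.injective).eq_iff]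

theorem card_rank_eq_and_rowSpace_add_eq_f1 (M : Matrix (Fin n) (Fin m) F)
    (V : Submodule F (Fin m → F)) (s : ℕ) :
    Nat.card {B : Matrix (Fin n) (Fin m) F // B.rank = s ∧ rowSpace (M + B) = V} =
      f1 F n m M.rank (Module.finrank F V) (quotDim (rowSpace M) V) s := by
  have h : ∃ p : Matrix (Fin n) (Fin m) F × Submodule F (Fin m → F), p.1.rank = M.rank ∧
      Module.finrank F p.2 = Module.finrank F V ∧
        quotDim (rowSpace p.1) p.2 = quotDim (rowSpace M) V := ⟨(M, V), rfl, rfl, rfl⟩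
  rw [f1, dif_pos h]
  obtain ⟨h₁, h₂, h₃⟩ := h.choose_spec
  exact card_rank_eq_and_rowSpace_add_eq_of_quotDim_eq h₁.symm h₂.symm h₃.symm s

theorem rowSpace_add_le (A B : Matrix (Fin n) (Fin m) F) :
    rowSpace (A + B) ≤ rowSpace A ⊔ rowSpace B := by
  refine Submodule.span_le.2 ?_
  rintro _ ⟨i, rfl⟩
  exact Submodule.add_mem_sup (Submodule.subset_span ⟨i, rfl⟩) (Submodule.subset_span ⟨i, rfl⟩)

theorem rowSpace_neg (A : Matrix (Fin n) (Fin m) F) : rowSpace (-A) = rowSpace A := by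
  refine le_antisymm (Submodule.span_le.2 ?_) (Submodule.span_le.2 ?_)
  · rintro _ ⟨i, rfl⟩
    exact Submodule.neg_mem _ (Submodule.subset_span ⟨i, rfl⟩)
  · rintro _ ⟨i, rfl⟩
    exact (Submodule.neg_mem_iff _).1 (Submodule.subset_span ⟨i, rfl⟩)

theorem finrank_sup_eq_add_quotDim (S V : Submodule F (Fin m → F)) :
    Module.finrank F (S ⊔ V : Submodule F (Fin m → F)) = Module.finrank F V + quotDim S V := by
  have h₁ := Submodule.finrank_sup_add_finrank_inf_eq S V
  have h₂ := quotDim_add_finrank_inf S V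
  omega

/-- From `M = (M + B) - B`. This and the next bound, from `B = (M + B) - M`, account for the range
`h ≤ s ≤ v + h` in `rowProb`. -/
theorem quotDim_le_rank (M B : Matrix (Fin n) (Fin m) F) :
    quotDim (rowSpace M) (rowSpace (M + B)) ≤ B.rank := by
  have h : rowSpace M ⊔ rowSpace (M + B) ≤ rowSpace (M + B) ⊔ rowSpace B := by
    refine sup_le ?_ le_sup_left
    simpa [rowSpace_neg] using rowSpace_add_le (M + B) (-B)
  have h₁ := Submodule.finrank_mono h
  have h₂ := Submodule.finrank_add_le_finrank_add_finrank (rowSpace (M + B)) (rowSpace B)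
  rw [finrank_sup_eq_add_quotDim] at h₁
  rw [finrank_rowSpace B] at h₂
  omega

theorem rank_le_finrank_add_quotDim (M B : Matrix (Fin n) (Fin m) F) :
    B.rank ≤ Module.finrank F (rowSpace (M + B)) + quotDim (rowSpace M) (rowSpace (M + B)) := by
  rw [← finrank_sup_eq_add_quotDim, ← finrank_rowSpace]
  refine Submodule.finrank_mono ?_
  simpa [rowSpace_neg] using rowSpace_add_le (-M) (M + B)

end Matrices

/-! ### The output law and its entropy -/

section Probability

theorem toReal_map_apply {α β : Type*} [Fintype α] [DecidableEq β] (p : PMF α) (f : α → β)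
    (b : β) : (p.map f b).toReal = ∑ a with f a = b, (p a).toReal := by
  rw [PMF.map_apply, tsum_fintype, ENNReal.toReal_sum fun a _ => ?_, Finset.sum_filter]
  · refine Finset.sum_congr rfl fun a _ => ?_
    by_cases h : f a = b
    · simp [h]
    · simp [h, Ne.symm h]
  · split_ifs
    · exact p.apply_ne_top a
    · simp

theorem toReal_bind_apply {α β : Type*} [Fintype α] (p : PMF α) (f : α → PMF β) (b : β) :
    (p.bind f b).toReal = ∑ a, (p a).toReal * (f a b).toReal := by
  rw [PMF.bind_apply, tsum_fintype, ENNReal.toReal_sum fun a _ =>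
    ENNReal.mul_ne_top (p.apply_ne_top a) ((f a).apply_ne_top b)]
  simp

variable {F : Type*} [Field F] [Fintype F] [DecidableEq F] {n m : ℕ}

/-- `A ↦ P A` permutes `GL(n)` and so preserves the uniform law of `A`. -/
theorem outputLaw_gl_mul (R : PMF (Fin (min n m + 1))) (M Y : Matrix (Fin n) (Fin m) F)
    (P : GL (Fin n) F) :
    outputLaw R M ((P : Matrix (Fin n) (Fin n) F) * Y) = outputLaw R M Y := by
  rw [outputLaw, PMF.bind_apply, PMF.bind_apply, ← (Equiv.mulLeft P).tsum_eq]
  refine tsum_congr fun A => ?_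
  simp only [Equiv.coe_mulLeft, PMF.uniformOfFintype_apply, PMF.map_apply, Units.val_mul,
    Matrix.mul_assoc]
  congr 2
  funext B
  have hinj : (P : Matrix (Fin n) (Fin n) F) * Y =
      (P : Matrix (Fin n) (Fin n) F) * ((A : Matrix (Fin n) (Fin n) F) * (M + B)) ↔
        Y = (A : Matrix (Fin n) (Fin n) F) * (M + B) := by
    refine ⟨fun h => ?_, fun h => h ▸ rfl⟩
    have h' := congrArg (((P⁻¹ : GL (Fin n) F) : Matrix (Fin n) (Fin n) F) * ·) h
    simpa only [← Matrix.mul_assoc, Units.inv_mul, Matrix.one_mul] using h'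
  simp only [hinj]
  split_ifs <;> rfl

theorem outputLaw_map_rowSpace (R : PMF (Fin (min n m + 1))) (M : Matrix (Fin n) (Fin m) F) :
    (outputLaw R M).map rowSpace = (ugr F n m R).map fun B => rowSpace (M + B) := by
  rw [outputLaw, PMF.map_bind]
  simp only [PMF.map_comp, Function.comp_def, rowSpace_gl_mul]
  exact PMF.bind_const _ _

open Classical in
theorem toReal_uniformRank_map_rowSpace_apply (M : Matrix (Fin n) (Fin m) F)
    (s : Fin (min n m + 1)) (V : Submodule F (Fin m → F)) :
    ((uniformRank F n m s).map (fun B => rowSpace (M + B)) V).toReal =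
      (f1 F n m M.rank (Module.finrank F V) (quotDim (rowSpace M) V) s : ℝ) /
        (numRank F n m s : ℝ) := by
  rw [toReal_map_apply, ← card_rank_eq_and_rowSpace_add_eq_f1, numRank, Nat.card_eq_fintype_card,
    Nat.card_eq_fintype_card, Fintype.card_subtype, Fintype.card_subtype]
  simp only [uniformRank, PMF.uniformOfFinset_apply, Finset.mem_filter, Finset.mem_univ, true_and]
  rw [Finset.sum_congr rfl fun B _ => (apply_ite ENNReal.toReal _ _ _),
    ENNReal.toReal_zero, ← Finset.sum_filter,
    Finset.filter_filter, Finset.sum_const, nsmul_eq_mul]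
  simp [div_eq_mul_inv, and_comm]

/-- The probability that the output has row space `V`. -/
theorem toReal_outputLaw_map_rowSpace_apply (R : PMF (Fin (min n m + 1)))
    (M : Matrix (Fin n) (Fin m) F) (V : Submodule F (Fin m → F)) :
    ((outputLaw R M).map rowSpace V).toReal =
      rowProb F n m R M.rank (Module.finrank F V) (quotDim (rowSpace M) V) := by
  rw [outputLaw_map_rowSpace, ugr, PMF.map_bind, toReal_bind_apply, rowProb,
    Finset.sum_filter_of_ne fun s _ hs => ?_]
  · simp only [toReal_uniformRank_map_rowSpace_apply]
  · rw [← card_rank_eq_and_rowSpace_add_eq_f1] at hs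
    -- A nonzero term comes from an actual `B`, and its rank obeys the two bounds; the truncation in
    -- `rowProb` thus loses nothing.
    obtain ⟨⟨B, hB, rfl⟩⟩ : Nonempty {B : Matrix (Fin n) (Fin m) F //
        B.rank = s ∧ rowSpace (M + B) = V} := by
      by_contra h
      rw [not_nonempty_iff] at h
      simp at hs
    rw [← hB]
    exact ⟨quotDim_le_rank M B, rank_le_finrank_add_quotDim M B⟩

open Classical in
/-- The output is uniform given its row space. -/
theorem rowProb_eq_f0_mul_outputLaw (R : PMF (Fin (min n m + 1)))
    (M Y : Matrix (Fin n) (Fin m) F) :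
    rowProb F n m R M.rank (Module.finrank F (rowSpace Y)) (quotDim (rowSpace M) (rowSpace Y)) =
      f0 F n m (Module.finrank F (rowSpace Y)) * (outputLaw R M Y).toReal := by
  rw [← toReal_outputLaw_map_rowSpace_apply, toReal_map_apply, ← card_rowSpace_eq_f0,
    Nat.card_eq_fintype_card, Fintype.card_subtype, ← nsmul_eq_mul]
  refine Finset.sum_eq_card_nsmul fun Z hZ => ?_
  obtain ⟨P, rfl⟩ := exists_gl_mul_eq (Finset.mem_filter.1 hZ).2.symm
  rw [outputLaw_gl_mul]

open Classical in
theorem rowProb_eq_zero_of_f0_eq_zero (R : PMF (Fin (min n m + 1)))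
    (M : Matrix (Fin n) (Fin m) F) (V : Submodule F (Fin m → F))
    (h : f0 F n m (Module.finrank F V) = 0) :
    rowProb F n m R M.rank (Module.finrank F V) (quotDim (rowSpace M) V) = 0 := by
  rw [← toReal_outputLaw_map_rowSpace_apply, toReal_map_apply]
  rw [← card_rowSpace_eq_f0, Nat.card_eq_fintype_card, Fintype.card_subtype,
    Finset.card_eq_zero] at h
  rw [h, Finset.sum_empty]

open Classical in
/-- The entropy as a sum over the row spaces of the output. -/
theorem entropy_outputLaw_eq_sum_submodule (R : PMF (Fin (min n m + 1))) (b : ℝ)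
    (M : Matrix (Fin n) (Fin m) F) :
    entropy b (outputLaw R M) = ∑ V : Submodule F (Fin m → F),
      rowProb F n m R M.rank (Module.finrank F V) (quotDim (rowSpace M) V) *
        Real.logb b ((f0 F n m (Module.finrank F V) : ℝ) /
          rowProb F n m R M.rank (Module.finrank F V) (quotDim (rowSpace M) V)) := by
  rw [entropy, ← Finset.sum_fiberwise (s := Finset.univ) (g := rowSpace), ← Finset.sum_neg_distrib]
  refine Finset.sum_congr rfl fun V _ => ?_
  have hcard : (Finset.univ.filter fun Y : Matrix (Fin n) (Fin m) F => rowSpace Y = V).card =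
      f0 F n m (Module.finrank F V) := by
    rw [← card_rowSpace_eq_f0, Nat.card_eq_fintype_card, Fintype.card_subtype]
  rcases Nat.eq_zero_or_pos (f0 F n m (Module.finrank F V)) with h | h
  · rw [rowProb_eq_zero_of_f0_eq_zero R M V h, Finset.card_eq_zero.1 (hcard.trans h)]
    simp
  · obtain ⟨Y, hY⟩ := Finset.card_pos.1 (hcard.symm ▸ h)
    obtain rfl := (Finset.mem_filter.1 hY).2
    -- On this fibre `f₀ / p` is the inverse of the common probability, also when that is `0`, since
    -- `0⁻¹ = 0`.
    rw [rowProb_eq_f0_mul_outputLaw, Finset.sum_eq_card_nsmul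
      (b := (outputLaw R M Y).toReal * Real.logb b (outputLaw R M Y).toReal), hcard,
      div_mul_cancel_left₀ (by positivity), Real.logb_inv, nsmul_eq_mul]
    · ring
    · intro Z hZ
      obtain ⟨P, rfl⟩ := exists_gl_mul_eq (Finset.mem_filter.1 hZ).2.symm
      rw [outputLaw_gl_mul]

open Classical in
/-- Grouping the row spaces `V` by `dim V` and `dim ((row M + V) / V)`. -/
theorem entropy_outputLaw_eq_sum_card (R : PMF (Fin (min n m + 1))) (b : ℝ)
    (M : Matrix (Fin n) (Fin m) F) :
    entropy b (outputLaw R M) =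
      ∑ v ∈ Finset.range (min n m + 1), ∑ h ∈ Finset.range (M.rank + 1),
        (Nat.card {V : Submodule F (Fin m → F) //
          Module.finrank F V = v ∧ quotDim (rowSpace M) V = h} : ℝ) *
          (rowProb F n m R M.rank v h *
            Real.logb b ((f0 F n m v : ℝ) / rowProb F n m R M.rank v h)) := by
  rw [entropy_outputLaw_eq_sum_submodule, ← Finset.sum_filter_of_ne
    (p := fun V : Submodule F (Fin m → F) => Module.finrank F V < min n m + 1) fun V _ hV => ?_,
    ← Finset.sum_product', ← Finset.sum_fiberwise_of_maps_to
      (t := Finset.range (min n m + 1) ×ˢ Finset.range (M.rank + 1))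
      (g := fun V : Submodule F (Fin m → F) => (Module.finrank F V, quotDim (rowSpace M) V)) fun V hV => ?_]
  · refine Finset.sum_congr rfl fun ⟨v, h⟩ hvh => ?_
    rw [Finset.sum_congr rfl (g := fun _ => rowProb F n m R M.rank v h *
      Real.logb b ((f0 F n m v : ℝ) / rowProb F n m R M.rank v h)) fun V hV => ?_,
      Finset.sum_const, nsmul_eq_mul, Nat.card_eq_fintype_card, Fintype.card_subtype]
    · congr 3
      ext V
      have hv := Finset.mem_range.1 (Finset.mem_product.1 hvh).1
      simp only [Finset.mem_filter, Finset.mem_univ, true_and, Prod.mk.injEq]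
      exact ⟨fun hV => hV.2, fun hV => ⟨hV.1 ▸ hv, hV⟩⟩
    · obtain ⟨rfl, rfl⟩ := Prod.ext_iff.1 (Finset.mem_filter.1 hV).2
      rfl
  · have h := quotDim_add_finrank_inf (rowSpace M) V
    rw [finrank_rowSpace] at h
    rw [Finset.mem_product, Finset.mem_range, Finset.mem_range]
    exact ⟨(Finset.mem_filter.1 hV).2, by dsimp only; omega⟩
  -- A subspace that contributes is the row space of some matrix, so its dimension is at most `min n
  -- m`.
  · have h : f0 F n m (Module.finrank F V) ≠ 0 := fun h =>
      hV (by rw [rowProb_eq_zero_of_f0_eq_zero R M V h, zero_mul])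
    rw [← card_rowSpace_eq_f0] at h
    obtain ⟨⟨Y, rfl⟩⟩ := (Nat.card_ne_zero.1 h).1
    rw [finrank_rowSpace, Nat.lt_succ_iff]
    exact le_min Y.rank_le_height Y.rank_le_width

end Probability

end GammaChannel

theorem theorem6p1 {F : Type*} [Field F] [Fintype F] [DecidableEq F] (n m : ℕ)
    (R : PMF (Fin (min n m + 1))) (b : ℝ) (hb : 1 < b)
    (r : ℕ) (M : Matrix (Fin n) (Fin m) F) (hM : M.rank = r) :
    -- `f₀` does not depend on the choice of the subspace
    (∀ U : Submodule F (Fin m → F),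
      Nat.card {M' : Matrix (Fin n) (Fin m) F // GammaChannel.rowSpace M' = U} =
        GammaChannel.f0 F n m (Module.finrank F U)) ∧
    -- `f₁` does not depend on the choice of the matrix and of the subspace
    (∀ (M' : Matrix (Fin n) (Fin m) F) (V : Submodule F (Fin m → F)) (s : ℕ),
      Nat.card {B : Matrix (Fin n) (Fin m) F //
          B.rank = s ∧ GammaChannel.rowSpace (M' + B) = V} =
        GammaChannel.f1 F n m M'.rank (Module.finrank F V)
          (GammaChannel.quotDim (GammaChannel.rowSpace M') V) s) ∧
    -- the value of `h_r`
    GammaChannel.entropy b (GammaChannel.outputLaw R M) =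
      ∑ v ∈ Finset.range (min n m + 1), ∑ h ∈ Finset.range (r + 1),
        (Fintype.card F : ℝ) ^ (((v : ℤ) - r + h) * h) *
          (GammaChannel.gaussBinom F (m - r) ((v : ℤ) - r + h) : ℝ) *
          (GammaChannel.gaussBinom F r ((r : ℤ) - h) : ℝ) *
          (GammaChannel.rowProb F n m R r v h *
            Real.logb b ((GammaChannel.f0 F n m v : ℝ) /
              GammaChannel.rowProb F n m R r v h)) := by
  subst hM
  refine ⟨GammaChannel.card_rowSpace_eq_f0, GammaChannel.card_rank_eq_and_rowSpace_add_eq_f1, ?_⟩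
  rw [GammaChannel.entropy_outputLaw_eq_sum_card]
  refine Finset.sum_congr rfl fun v _ => Finset.sum_congr rfl fun h hh => ?_
  rw [GammaChannel.card_submodule_quotDim_eq _ (GammaChannel.finrank_rowSpace M)
    (Nat.lt_succ_iff.1 (Finset.mem_range.1 hh))]
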